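/- Let $\Delta=(Q,\Gamma,\delta)$ be a probabilistic pushdown automaton (pPDA): $Q$ is a finite set of states, $\Gamma$ a finite stack alphabet, and each transition $pZ\xrightarrow{a}q\alpha$ (with $p,q\in Q$, $Z\in\Gamma$, $\alpha\in\Gamma^*$, $|\alpha|\le 2$) has a rational weight $a\ge 0$, at most one for each $p,Z,q,\alpha$, such that the weights of the transitions from $pZ$ sum to $1$ for every $pZ\in Q\times\Gamma$. On the configurations $Q\times\Gamma^*$ let $M$ be the matrix with $M(pZ\beta,q\alpha\beta)=a$ for every transition $pZ\xrightarrow{a}q\alpha$ and every $\beta\in\Gamma^*$, and with all other entries zero, and let $F=Q\times\{\varepsilon\}$. The expected runtime from a configuration $c$ is $\mathsf{ert}[c]=\big(\sum_{k\ge 0}M_F^k(\mathbf 1-\chi_F)\big)_c\in[0,\infty]$, where $\chi_F$ is the indicator vector of $F$ and $M_F$ is $M$ with the rows in $F$ set to zero. $\Delta$ is positively almost-surely terminating (PAST) if $\mathsf{ert}[c]<\infty$ for every configuration $c$. The fundamental system $f$ of $\Delta$ is given, for $u\in\mathbb{R}_{\ge 0}^{Q\times\Gamma\times Q}$ and $pZq\in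 Q\times\Gamma\times Q$, by $$f(u)_{pZq}=\sum_{pZ\xrightarrow{a}q\varepsilon}a+\sum_{pZ\xrightarrow{a}rY}a\,u_{rYq}+\sum_{pZ\xrightarrow{a}rYX}a\sum_{t\in Q}u_{rYt}\,u_{tXq},$$ and $M_\Delta(u)$ is the $(Q\times\Gamma)\times(Q\times\Gamma)$ matrix such that, for every vector $v$ and all $pZ\in Q\times\Gamma$, $$(M_\Delta(u)\,v)_{pZ}=\sum_{pZ\xrightarrow{a}rY}a\,v_{rY}+\sum_{pZ\xrightarrow{a}rYX}a\Big(v_{rY}+\sum_{t\in Q}u_{rYt}\,v_{tX}\Big).$$ Then $\Delta$ is PAST if and only if there are rational vectors $u\in\mathbb{Q}_{\ge 0}^{Q\times\Gamma\times Q}$ and $r\in\mathbb{Q}_{\ge 1}^{Q\times\Gamma}$ such that $f(u)\le u$ and $M_\Delta(u)\,r+\mathbf 1\le r$ (componentwise). Moreover, for any such $u$ and $r$, $\mathsf{ert}[pZ]\le r_{pZ}$ for all $pZ\in Q\times\Gamma$. -/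

import Mathlib

/-! Discrete transition systems, given by a non-negative matrix over an arbitrary state set. -/

/-- The matrix `M_F`: all rows of `M` that are indexed by target states are set to zero. -/
noncomputable def zeroTargetRows {S : Type*} (M : S → S → ENNReal) (F : Set S) :
    S → S → ENNReal :=
  Fᶜ.indicator M

/-- The product `M v` of a non-negative matrix and a non-negative vector, over an arbitrary
index set. -/
noncomputable def applyMat {S : Type*} (M : S → S → ENNReal) (v : S → ENNReal) :
    S → ENNReal :=
  fun s => ∑' t, M s t * v t

/-- The expected runtime of the system `M` with respect to the target set `F` and the initial
state `s`: the component at `s` of the vector `∑ k, M_F ^ k (1 - χ_F)`. -/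
noncomputable def expectedRuntime {S : Type*} (M : S → S → ENNReal) (F : Set S) (s : S) :
    ENNReal :=
  ∑' k : ℕ, (applyMat (zeroTargetRows M F))^[k] (Fᶜ.indicator 1) s

/-- Positive almost-sure termination: the expected runtime is finite from every state. -/
def PositivelyAlmostSurelyTerminating {S : Type*} (M : S → S → ENNReal) (F : Set S) : Prop :=
  ∀ s, expectedRuntime M F s < ⊤

/-- A weighted pushdown automaton with states `Q`, stack alphabet `Γ` and non-negative rational
weights. `weight p Z q α` is the weight of the transition that, in state `p` and with `Z` on top
of the stack, moves to state `q` and replaces `Z` by `α`, a word of length at most two; weight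
zero means that there is no such transition. -/
structure WeightedPDA (Q Γ : Type*) where
  weight : Q → Γ → Q → List Γ → ℚ≥0
  weight_eq_zero : ∀ p Z q α, 2 < α.length → weight p Z q α = 0

namespace WeightedPDA

variable {Q Γ : Type*}

/-- A weighted PDA is probabilistic if, for every state `p` and every stack symbol `Z`, the
weights of the transitions from `pZ` sum to one. -/
def IsProbabilistic [Fintype Q] [Fintype Γ] (Δ : WeightedPDA Q Γ) : Prop :=
  ∀ p Z, ∑ q, (Δ.weight p Z q [] + ∑ Y, Δ.weight p Z q [Y] +
    ∑ Y, ∑ X, Δ.weight p Z q [Y, X]) = 1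

open Classical in
/-- The transition matrix on configurations (a state and a stack content, top first): the entry
at `(pZβ, qαβ)` is the weight of the transition from `pZ` to `qα`, and all other entries are
zero. -/
noncomputable def configMatrix (Δ : WeightedPDA Q Γ) :
    Q × List Γ → Q × List Γ → ENNReal
  | (_, []), _ => 0
  | (p, Z :: β), (q, γ) =>
      ∑' α : List Γ, if γ = α ++ β then ((Δ.weight p Z q α : NNReal) : ENNReal) else 0

/-- The configurations with empty stack. -/
def emptyStack (Q Γ : Type*) : Set (Q × List Γ) := {c | c.2 = []}

/-- The expected runtime from the configuration `pZ` until the stack is empty. -/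
noncomputable def ert (Δ : WeightedPDA Q Γ) (p : Q) (Z : Γ) : ENNReal :=
  expectedRuntime Δ.configMatrix (emptyStack Q Γ) (p, [Z])

/-- Positive almost-sure termination with respect to the empty-stack configurations. -/
def IsPAST (Δ : WeightedPDA Q Γ) : Prop :=
  PositivelyAlmostSurelyTerminating Δ.configMatrix (emptyStack Q Γ)

/-- The fundamental positive polynomial system, with one variable and one polynomial for each
triple `pZq`. -/
noncomputable def fundamentalPPS [Fintype Q] [Fintype Γ] (Δ : WeightedPDA Q Γ) :
    Q × Γ × Q → MvPolynomial (Q × Γ × Q) ℚ≥0 :=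
  fun (p, Z, q) =>
    MvPolynomial.C (Δ.weight p Z q []) +
    ∑ r, ∑ Y, MvPolynomial.C (Δ.weight p Z r [Y]) * MvPolynomial.X (r, Y, q) +
    ∑ r, ∑ Y, ∑ X, MvPolynomial.C (Δ.weight p Z r [Y, X]) *
      ∑ t, MvPolynomial.X (r, Y, t) * MvPolynomial.X (t, X, q)

/-- The matrix `M_Δ(u)` of the linear system of expected runtimes
`e(pZ) = 1 + ∑ (pZ → rY) a * e(rY) + ∑ (pZ → rYX) a * (e(rY) + ∑ t, u(rYt) * e(tX))`,
where `a` stands for the weight of the transition. -/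
def runtimeMatrix [Fintype Q] [Fintype Γ] (Δ : WeightedPDA Q Γ) (u : Q × Γ × Q → ℚ≥0) :
    Matrix (Q × Γ) (Q × Γ) ℚ≥0 :=
  fun (p, Z) (t, W) =>
    Δ.weight p Z t [W] + ∑ X, Δ.weight p Z t [W, X] +
    ∑ r, ∑ Y, Δ.weight p Z r [Y, W] * u (r, Y, t)

/-- The pair `(u, r)` satisfies `f(u) ≤ u`, `r ≥ 1` and `M_Δ(u) r + 1 ≤ r`; the entries of `u`
and `r` are non-negative rationals. -/
def IsPASTCertificate [Fintype Q] [Fintype Γ] (Δ : WeightedPDA Q Γ)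
    (u : Q × Γ × Q → ℚ≥0) (r : Q × Γ → ℚ≥0) : Prop :=
  (∀ i, MvPolynomial.eval u (Δ.fundamentalPPS i) ≤ u i) ∧
    (∀ j, 1 ≤ r j) ∧ (∀ j, (Δ.runtimeMatrix u).mulVec r j + 1 ≤ r j)

end WeightedPDA

/-! Sufficiency. Given `u` and `r`, the potential of a stack adds up the `r`-values of its symbols,
with the states in which lower symbols are exposed weighted by `u`. Decomposing one step
(`stepSum_potential`) and using `f(u) ≤ u` and `M_Δ(u) r + 1 ≤ r`, the potential drops by at least
one per step. The runtime is the least vector with this property (`neumann_le`), so it is bounded by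
the potential, which is finite and equals `r` on one-symbol stacks.

Necessity. The termination probabilities `x` and the expected runtimes `e` of one-symbol stacks
satisfy both inequalities, but may be irrational. Strict solutions can be rounded to rational ones,
so slack is created. Let `D` be the derivative of `f` at `x`, `B` its quadratic part, and `v = ∑ D^k
1`. Then `v = 1 + D v`, whence `f(x + εv) ≤ x + εv - ε(1 - ε B(v,v))`, which is strictly below `x +
εv` for small `ε > 0`. The series is finite because `x` is substochastic: after summation over final
states `D` is dominated by `M_Δ(x)`, and `M_Δ(x) e + 1 ≤ e` with `e` finite
(`neumann_fundamentalDeriv_lt_top`). Doubling `e` gives room in the second inequality. -/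

section

open Finset

/-! Sums of the iterates of a countably additive operator on `ENNReal`-valued vectors. -/

/-- An operator on non-negative vectors that commutes with finite and countable sums. -/
structure CountablyAdditive {S : Type*} (T : (S → ENNReal) → S → ENNReal) : Prop where
  map_zero : T 0 = 0
  map_add : ∀ v w, T (v + w) = T v + T w
  map_tsum : ∀ v : ℕ → S → ENNReal, T (fun s => ∑' k, v k s) = fun s => ∑' k, T (v k) s

/-- The first `n` terms of the Neumann series of `T` at `g`. -/
noncomputable def partialNeumann {S : Type*} (T : (S → ENNReal) → S → ENNReal)
    (g : S → ENNReal) (n : ℕ) : S → ENNReal :=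
  ∑ k ∈ range n, T^[k] g

/-- The Neumann series of `T` at `g`. -/
noncomputable def neumann {S : Type*} (T : (S → ENNReal) → S → ENNReal)
    (g : S → ENNReal) : S → ENNReal :=
  fun s => ∑' k, T^[k] g s

section Neumann

variable {S : Type*} {T : (S → ENNReal) → S → ENNReal}

@[simp] theorem partialNeumann_zero (g : S → ENNReal) : partialNeumann T g 0 = 0 := by
  simp [partialNeumann]

theorem partialNeumann_apply (g : S → ENNReal) (n : ℕ) (s : S) :
    partialNeumann T g n s = ∑ k ∈ range n, T^[k] g s := by
  simp [partialNeumann]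

theorem CountablyAdditive.mono (hT : CountablyAdditive T) : Monotone T := by
  intro v w h
  rw [← add_tsub_cancel_of_le h, hT.map_add]
  exact le_self_add

theorem CountablyAdditive.map_sum (hT : CountablyAdditive T) (v : ℕ → S → ENNReal) (n : ℕ) :
    T (∑ k ∈ range n, v k) = ∑ k ∈ range n, T (v k) := by
  induction n with
  | zero => simpa using hT.map_zero
  | succ n ih => rw [sum_range_succ, sum_range_succ, hT.map_add, ih]

theorem partialNeumann_succ (hT : CountablyAdditive T) (g : S → ENNReal) (n : ℕ) :
    partialNeumann T g (n + 1) = g + T (partialNeumann T g n) := by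
  rw [partialNeumann, partialNeumann, hT.map_sum, sum_range_succ', add_comm]
  simp [Function.iterate_succ_apply']

theorem neumann_eq (hT : CountablyAdditive T) (g : S → ENNReal) :
    neumann T g = g + T (neumann T g) := by
  funext s
  change ∑' k, T^[k] g s = g s + T (fun s => ∑' k, T^[k] g s) s
  rw [hT.map_tsum, tsum_eq_zero_add' ENNReal.summable]
  simp [Function.iterate_succ_apply']

theorem neumann_le_of_partialNeumann_le {g : S → ENNReal} {s : S} {c : ENNReal}
    (h : ∀ n, partialNeumann T g n s ≤ c) : neumann T g s ≤ c :=
  ENNReal.tsum_le_of_sum_range_le fun n => by rw [← partialNeumann_apply]; exact h n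

/-- Induction on the partial sums: if one is below `R`, the next is below `g + T R ≤ R`. With
`neumann_eq`, this makes the series the least super-solution. -/
theorem neumann_le (hT : CountablyAdditive T) {g R : S → ENNReal} (h : g + T R ≤ R) :
    neumann T g ≤ R := by
  intro s
  refine neumann_le_of_partialNeumann_le fun n => ?_
  suffices partialNeumann T g n ≤ R from this s
  induction n with
  | zero => simp
  | succ n ih =>
    rw [partialNeumann_succ hT]
    exact (add_le_add le_rfl (hT.mono ih)).trans h

end Neumann

theorem applyMat_countablyAdditive {S : Type*} (M : S → S → ENNReal) :
    CountablyAdditive (applyMat M) where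
  map_zero := by funext s; simp [applyMat]
  map_add v w := by
    funext s
    simp [applyMat, mul_add, ENNReal.tsum_add]
  map_tsum v := by
    funext s
    simp only [applyMat, ← ENNReal.tsum_mul_left]
    exact ENNReal.tsum_comm

/-! ### Sums over words. -/

theorem ENNReal.tsum_list {α : Type*} (g : List α → ENNReal) :
    ∑' l, g l = g [] + ∑' a, ∑' l, g (a :: l) := by
  let e : Unit ⊕ α × List α ≃ List α :=
    { toFun := Sum.elim (fun _ => []) (fun x => x.1 :: x.2)
      invFun := fun l => match l with
        | [] => Sum.inl ()
        | a :: l => Sum.inr (a, l)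
      left_inv := by rintro (_ | ⟨a, l⟩) <;> rfl
      right_inv := by rintro (_ | ⟨a, l⟩) <;> rfl }
  rw [← e.tsum_eq, Summable.tsum_sum ENNReal.summable ENNReal.summable]
  simp only [tsum_fintype, univ_unique, sum_singleton]
  congr 1
  exact ENNReal.tsum_prod (f := fun a l => g (a :: l))

/-- A sum over lists that is supported on lists of length at most two. -/
theorem ENNReal.tsum_list_of_length_le_two {α : Type*} [Fintype α] (g : List α → ENNReal)
    (hg : ∀ l, 2 < l.length → g l = 0) :
    ∑' l, g l = g [] + ∑ a, g [a] + ∑ a, ∑ b, g [a, b] := by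
  have h0 : ∀ a b c l, g (a :: b :: c :: l) = 0 := fun a b c l => hg _ (by simp)
  rw [ENNReal.tsum_list, add_assoc, ← sum_add_distrib, tsum_fintype]
  congr 1
  refine sum_congr rfl fun a _ => ?_
  rw [ENNReal.tsum_list, tsum_fintype]
  congr 1
  refine sum_congr rfl fun b _ => ?_
  rw [ENNReal.tsum_list]
  simp [h0]

/-! Transition sums of a weighted pushdown automaton, over an arbitrary semiring. -/

namespace WeightedPDA

variable {Q Γ R : Type*} [Fintype Q] [Fintype Γ] [CommSemiring R]

/-- The sum over all transitions `pZ → qα` of the weight times `g q α`. -/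
def stepSum (w : Q → Γ → Q → List Γ → R) (p : Q) (Z : Γ) (g : Q → List Γ → R) : R :=
  ∑ q, (w p Z q [] * g q [] + ∑ Y, w p Z q [Y] * g q [Y] +
    ∑ Y, ∑ X, w p Z q [Y, X] * g q [Y, X])

/-- The linear part of the fundamental system. -/
def linearPart (w : Q → Γ → Q → List Γ → R) (x : Q × Γ × Q → R) : Q × Γ × Q → R :=
  fun (p, Z, q) => ∑ r, ∑ Y, w p Z r [Y] * x (r, Y, q)

/-- The quadratic part of the fundamental system, as a bilinear map. -/
def bilinearPart (w : Q → Γ → Q → List Γ → R) (x y : Q × Γ × Q → R) : Q × Γ × Q → R :=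
  fun (p, Z, q) => ∑ r, ∑ Y, ∑ X, w p Z r [Y, X] * ∑ t, x (r, Y, t) * y (t, X, q)

/-- The fundamental system. -/
def fundamental (w : Q → Γ → Q → List Γ → R) (x : Q × Γ × Q → R) : Q × Γ × Q → R :=
  fun i => w i.1 i.2.1 i.2.2 [] + linearPart w x i + bilinearPart w x x i

/-- The matrix of the linear system of expected runtimes, applied to a vector. -/
def runtimeMap (w : Q → Γ → Q → List Γ → R) (x : Q × Γ × Q → R) (v : Q × Γ → R) : Q × Γ → R :=
  fun (p, Z) => ∑ r, ∑ Y, w p Z r [Y] * v (r, Y) +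
    ∑ r, ∑ Y, ∑ X, w p Z r [Y, X] * (v (r, Y) + ∑ t, x (r, Y, t) * v (t, X))

/-- The potential of a configuration: the sum over all symbols of the stack of the values of `v`,
where the states at which the symbols are exposed are distributed according to `x`. -/
def potential (x : Q × Γ × Q → R) (v : Q × Γ → R) : List Γ → Q → R
  | [], _ => 0
  | Z :: β, p => v (p, Z) + ∑ t, x (p, Z, t) * potential x v β t

theorem eval_fundamentalPPS (Δ : WeightedPDA Q Γ) (u : Q × Γ × Q → ℚ≥0) (i : Q × Γ × Q) :
    MvPolynomial.eval u (Δ.fundamentalPPS i) = fundamental Δ.weight u i := by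
  obtain ⟨p, Z, q⟩ := i
  simp [fundamentalPPS, fundamental, linearPart, bilinearPart]

theorem runtimeMatrix_mulVec (Δ : WeightedPDA Q Γ) (u : Q × Γ × Q → ℚ≥0) (v : Q × Γ → ℚ≥0) :
    (Δ.runtimeMatrix u).mulVec v = runtimeMap Δ.weight u v := by
  funext ⟨p, Z⟩
  simp only [runtimeMatrix, runtimeMap, Matrix.mulVec, dotProduct, Fintype.sum_prod_type,
    add_mul, mul_add, sum_add_distrib, sum_mul, mul_sum]
  rw [add_assoc]
  congr 2
  simp only [← Fintype.sum_prod_type']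
  -- The matrix indexes the lower pushed symbol by its column `(t, W)`, outside the sum over `(r,
  -- Y)`; reindexing restores the order `r, Y, W, t`.
  refine Fintype.sum_equiv
    ⟨fun x => (x.2.2.1, x.2.2.2, x.2.1, x.1), fun x => (x.2.2.2, x.2.2.1, x.1, x.2.1),
      fun _ => rfl, fun _ => rfl⟩ _ _ fun x => ?_
  simp [mul_assoc]

theorem isPASTCertificate_iff (Δ : WeightedPDA Q Γ) (u : Q × Γ × Q → ℚ≥0) (r : Q × Γ → ℚ≥0) :
    Δ.IsPASTCertificate u r ↔ (∀ i, fundamental Δ.weight u i ≤ u i) ∧ (∀ j, 1 ≤ r j) ∧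
      ∀ j, runtimeMap Δ.weight u r j + 1 ≤ r j := by
  simp only [IsPASTCertificate, eval_fundamentalPPS, runtimeMatrix_mulVec]

section Map

variable {R' : Type*} [CommSemiring R'] (φ : R →+* R')

theorem map_fundamental (w : Q → Γ → Q → List Γ → R) (x : Q × Γ × Q → R) (i : Q × Γ × Q) :
    φ (fundamental w x i) = fundamental (fun p Z q α => φ (w p Z q α)) (fun j => φ (x j)) i := by
  simp [fundamental, linearPart, bilinearPart]

theorem map_runtimeMap (w : Q → Γ → Q → List Γ → R) (x : Q × Γ × Q → R) (v : Q × Γ → R)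
    (j : Q × Γ) : φ (runtimeMap w x v j) =
      runtimeMap (fun p Z q α => φ (w p Z q α)) (fun j => φ (x j)) (fun j => φ (v j)) j := by
  simp [runtimeMap]

end Map

/-- The first step decomposition of the potential. -/
theorem stepSum_potential (w : Q → Γ → Q → List Γ → R) (x : Q × Γ × Q → R) (v : Q × Γ → R)
    (p : Q) (Z : Γ) (β : List Γ) :
    stepSum w p Z (fun q α => potential x v (α ++ β) q) =
      runtimeMap w x v (p, Z) + ∑ q, fundamental w x (p, Z, q) * potential x v β q := by
  set P := potential x v β with hP
  have h1 : ∑ q, linearPart w x (p, Z, q) * P q =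
      ∑ r, ∑ Y, w p Z r [Y] * ∑ q, x (r, Y, q) * P q := by
    simp only [linearPart, sum_mul, mul_sum]
    rw [sum_comm]
    refine sum_congr rfl fun r _ => ?_
    rw [sum_comm]
    simp only [mul_assoc]
  have h2 : ∑ q, bilinearPart w x x (p, Z, q) * P q =
      ∑ r, ∑ Y, ∑ X, w p Z r [Y, X] * ∑ t, x (r, Y, t) * ∑ q, x (t, X, q) * P q := by
    simp only [bilinearPart, sum_mul, mul_sum]
    rw [sum_comm]
    refine sum_congr rfl fun r _ => ?_
    rw [sum_comm]
    refine sum_congr rfl fun Y _ => ?_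
    rw [sum_comm]
    refine sum_congr rfl fun X _ => ?_
    rw [sum_comm]
    simp only [mul_assoc]
  simp only [fundamental, add_mul, sum_add_distrib, h1, h2]
  simp only [stepSum, potential, List.nil_append, List.cons_append, ← hP, runtimeMap, mul_add,
    sum_add_distrib]
  ring

end WeightedPDA

/-! ### Runtimes and termination probabilities of configurations. -/

namespace WeightedPDA

variable {Q Γ : Type*}

/-- The embedding of the non-negative rationals into the extended non-negative reals. -/
noncomputable def ennrealCastHom : ℚ≥0 →+* ENNReal :=
  ENNReal.ofNNRealHom.comp (NNRat.castHom NNReal)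

theorem ennrealCastHom_apply (x : ℚ≥0) : ennrealCastHom x = ((x : NNReal) : ENNReal) :=
  rfl

/-- The transition weights as extended non-negative reals. -/
noncomputable def ennrealWeight (Δ : WeightedPDA Q Γ) (p : Q) (Z : Γ) (q : Q) (α : List Γ) :
    ENNReal :=
  ((Δ.weight p Z q α : NNReal) : ENNReal)

/-- One step of the automaton, stopped at the empty stack, as an operator on vectors. -/
noncomputable def stepOperator (Δ : WeightedPDA Q Γ) :
    (Q × List Γ → ENNReal) → Q × List Γ → ENNReal :=
  applyMat (zeroTargetRows Δ.configMatrix (emptyStack Q Γ))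

theorem stepOperator_countablyAdditive (Δ : WeightedPDA Q Γ) :
    CountablyAdditive Δ.stepOperator :=
  applyMat_countablyAdditive _

theorem stepOperator_nil (Δ : WeightedPDA Q Γ) (v : Q × List Γ → ENNReal) (p : Q) :
    Δ.stepOperator v (p, []) = 0 := by
  simp [stepOperator, applyMat, zeroTargetRows, emptyStack]

theorem stepOperator_cons [Fintype Q] [Fintype Γ] (Δ : WeightedPDA Q Γ)
    (v : Q × List Γ → ENNReal) (p : Q) (Z : Γ) (β : List Γ) :
    Δ.stepOperator v (p, Z :: β) =
      stepSum Δ.ennrealWeight p Z (fun q α => v (q, α ++ β)) := by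
  classical
  have hmem : ((p, Z :: β) : Q × List Γ) ∈ (emptyStack Q Γ)ᶜ := by simp [emptyStack]
  simp only [stepOperator, applyMat, zeroTargetRows, Set.indicator_of_mem hmem]
  rw [ENNReal.tsum_prod (f := fun q γ => Δ.configMatrix (p, Z :: β) (q, γ) * v (q, γ)),
    tsum_fintype, stepSum]
  refine sum_congr rfl fun q _ => ?_
  -- After exchanging the two sums, each word `α` contributes only at the configuration with stack
  -- `α ++ β`.
  have key : ∑' γ, Δ.configMatrix (p, Z :: β) (q, γ) * v (q, γ) =
      ∑' α, Δ.ennrealWeight p Z q α * v (q, α ++ β) := by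
    simp only [configMatrix, ← ENNReal.tsum_mul_right]
    rw [ENNReal.tsum_comm]
    refine tsum_congr fun α => ?_
    rw [tsum_eq_single (α ++ β) (fun γ hγ => by simp [hγ])]
    simp [ennrealWeight]
  rw [key, ENNReal.tsum_list_of_length_le_two]
  intro α hα
  simp [ennrealWeight, Δ.weight_eq_zero p Z q α hα]

theorem compl_emptyStack_indicator_nil (p : Q) :
    (emptyStack Q Γ)ᶜ.indicator (1 : Q × List Γ → ENNReal) (p, []) = 0 := by
  simp [emptyStack]

theorem compl_emptyStack_indicator_cons (p : Q) (Z : Γ) (β : List Γ) :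
    (emptyStack Q Γ)ᶜ.indicator (1 : Q × List Γ → ENNReal) (p, Z :: β) = 1 := by
  simp [emptyStack]

/-- The expected runtime from an arbitrary configuration. -/
noncomputable def configRuntime (Δ : WeightedPDA Q Γ) : Q × List Γ → ENNReal :=
  expectedRuntime Δ.configMatrix (emptyStack Q Γ)

theorem configRuntime_eq_neumann (Δ : WeightedPDA Q Γ) :
    Δ.configRuntime = neumann Δ.stepOperator ((emptyStack Q Γ)ᶜ.indicator 1) :=
  rfl

open Classical in
/-- The probability of reaching the empty stack in state `t`. -/
noncomputable def terminationProb (Δ : WeightedPDA Q Γ) (t : Q) : Q × List Γ → ENNReal :=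
  neumann Δ.stepOperator (Pi.single (t, []) 1)

open Classical in
theorem partialTermination_succ_nil (Δ : WeightedPDA Q Γ) (n : ℕ) (p t : Q) :
    partialNeumann Δ.stepOperator (Pi.single (t, []) 1) (n + 1) (p, []) =
      if p = t then 1 else 0 := by
  rw [partialNeumann_succ Δ.stepOperator_countablyAdditive, Pi.add_apply, stepOperator_nil]
  simp [Pi.single_apply]

open Classical in
theorem terminationProb_nil (Δ : WeightedPDA Q Γ) (p t : Q) :
    Δ.terminationProb t (p, []) = if p = t then 1 else 0 := by
  rw [terminationProb, neumann_eq Δ.stepOperator_countablyAdditive, Pi.add_apply,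
    stepOperator_nil]
  simp [Pi.single_apply]

theorem configRuntime_nil (Δ : WeightedPDA Q Γ) (p : Q) : Δ.configRuntime (p, []) = 0 := by
  rw [configRuntime_eq_neumann, neumann_eq Δ.stepOperator_countablyAdditive, Pi.add_apply,
    stepOperator_nil, compl_emptyStack_indicator_nil, add_zero]

theorem potential_lt_top [Fintype Q] {x : Q × Γ × Q → ENNReal} {v : Q × Γ → ENNReal}
    (hx : ∀ i, x i < ⊤) (hv : ∀ j, v j < ⊤) (α : List Γ) (p : Q) : potential x v α p < ⊤ := by
  induction α generalizing p with
  | nil => simp [potential]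
  | cons Z β ih =>
    rw [potential]
    exact ENNReal.add_lt_top.2 ⟨hv _, ENNReal.sum_lt_top.2 fun t _ =>
      ENNReal.mul_lt_top (hx _) (ih t)⟩

section Fintype

variable [Fintype Q] [Fintype Γ]

theorem stepSum_mono {w : Q → Γ → Q → List Γ → ENNReal} {p : Q} {Z : Γ}
    {g h : Q → List Γ → ENNReal} (hgh : ∀ q α, g q α ≤ h q α) :
    stepSum w p Z g ≤ stepSum w p Z h := by
  unfold stepSum
  gcongr <;> exact hgh _ _

theorem stepSum_add {w : Q → Γ → Q → List Γ → ENNReal} {p : Q} {Z : Γ}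
    (g h : Q → List Γ → ENNReal) :
    stepSum w p Z (fun q α => g q α + h q α) = stepSum w p Z g + stepSum w p Z h := by
  simp only [stepSum, mul_add, sum_add_distrib]
  ring

theorem stepSum_mul_right {w : Q → Γ → Q → List Γ → ENNReal} {p : Q} {Z : Γ}
    (g : Q → List Γ → ENNReal) (c : ENNReal) :
    stepSum w p Z (fun q α => g q α * c) = stepSum w p Z g * c := by
  simp only [stepSum, add_mul, sum_mul, mul_assoc]

theorem stepSum_sum {ι : Type*} {w : Q → Γ → Q → List Γ → ENNReal} {p : Q} {Z : Γ}
    (s : Finset ι) (g : ι → Q → List Γ → ENNReal) :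
    stepSum w p Z (fun q α => ∑ i ∈ s, g i q α) = ∑ i ∈ s, stepSum w p Z (g i) := by
  classical
  induction s using Finset.induction_on with
  | empty => simp [stepSum]
  | insert i s hi ih => simp only [sum_insert hi, stepSum_add, ih]

theorem IsProbabilistic.stepSum_one {Δ : WeightedPDA Q Γ} (hΔ : Δ.IsProbabilistic)
    (p : Q) (Z : Γ) : stepSum Δ.ennrealWeight p Z (fun _ _ => 1) = 1 := by
  have h := congrArg ennrealCastHom (hΔ p Z)
  simp only [map_sum, map_add, map_one, ennrealCastHom_apply] at h
  simpa only [stepSum, ennrealWeight, mul_one] using h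

/-- A certificate bounds the expected runtime of every configuration by its potential. -/
theorem configRuntime_le_potential (Δ : WeightedPDA Q Γ) {x : Q × Γ × Q → ENNReal}
    {v : Q × Γ → ENNReal} (hx : ∀ i, fundamental Δ.ennrealWeight x i ≤ x i)
    (hv : ∀ j, runtimeMap Δ.ennrealWeight x v j + 1 ≤ v j) (p : Q) (α : List Γ) :
    Δ.configRuntime (p, α) ≤ potential x v α p := by
  refine neumann_le Δ.stepOperator_countablyAdditive
    (R := fun c => potential x v c.2 c.1) ?_ (p, α)
  rintro ⟨p, _ | ⟨Z, β⟩⟩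
  · rw [Pi.add_apply, compl_emptyStack_indicator_nil]
    simp [stepOperator_nil]
  · rw [Pi.add_apply, compl_emptyStack_indicator_cons]
    change 1 + Δ.stepOperator _ _ ≤ _
    rw [stepOperator_cons, stepSum_potential, ← add_assoc, add_comm 1]
    simp only [potential]
    gcongr
    · exact hv _
    · exact hx _

open Classical in
theorem partialTermination_succ_cons (Δ : WeightedPDA Q Γ) (n : ℕ) (p t : Q) (Z : Γ)
    (β : List Γ) :
    partialNeumann Δ.stepOperator (Pi.single (t, []) 1) (n + 1) (p, Z :: β) =
      stepSum Δ.ennrealWeight p Z (fun q α =>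
        partialNeumann Δ.stepOperator (Pi.single (t, []) 1) n (q, α ++ β)) := by
  rw [partialNeumann_succ Δ.stepOperator_countablyAdditive, Pi.add_apply, stepOperator_cons]
  simp

theorem terminationProb_cons (Δ : WeightedPDA Q Γ) (p t : Q) (Z : Γ) (β : List Γ) :
    Δ.terminationProb t (p, Z :: β) = stepSum Δ.ennrealWeight p Z (fun q α =>
      Δ.terminationProb t (q, α ++ β)) := by
  conv_lhs => rw [terminationProb, neumann_eq Δ.stepOperator_countablyAdditive, Pi.add_apply,
    stepOperator_cons]
  simp [terminationProb]

theorem configRuntime_cons (Δ : WeightedPDA Q Γ) (p : Q) (Z : Γ) (β : List Γ) :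
    Δ.configRuntime (p, Z :: β) = 1 + stepSum Δ.ennrealWeight p Z (fun q α =>
      Δ.configRuntime (q, α ++ β)) := by
  conv_lhs => rw [configRuntime_eq_neumann, neumann_eq Δ.stepOperator_countablyAdditive,
    Pi.add_apply, stepOperator_cons, compl_emptyStack_indicator_cons]
  rfl

/-- The bound passes through each step because the weights from `pZ` sum to one. This is the only
use of the normalisation of the weights. -/
theorem sum_terminationProb_le_one {Δ : WeightedPDA Q Γ} (hΔ : Δ.IsProbabilistic)
    (c : Q × List Γ) : ∑ t, Δ.terminationProb t c ≤ 1 := by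
  classical
  have key : ∀ n, ∀ c : Q × List Γ,
      ∑ t, partialNeumann Δ.stepOperator (Pi.single (t, []) 1) n c ≤ 1 := by
    intro n
    induction n with
    | zero => simp
    | succ n ih =>
      rintro ⟨p, _ | ⟨Z, β⟩⟩
      · simp [partialTermination_succ_nil]
      · simp only [partialTermination_succ_cons]
        rw [← stepSum_sum]
        exact (stepSum_mono fun q α => ih _).trans (hΔ.stepSum_one p Z).le
  simp only [terminationProb, neumann]
  rw [← Summable.tsum_finsetSum fun _ _ => ENNReal.summable]
  refine ENNReal.tsum_le_of_sum_range_le fun n => ?_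
  rw [sum_comm]
  simpa only [partialNeumann_apply] using key n c

/-- A vector that is superharmonic with reward `a` per step dominates, on a concatenated stack,
the reward collected until the upper part is removed plus the expected value afterwards. -/
theorem superharmonic_append (Δ : WeightedPDA Q Γ) {a : ENNReal} {h : Q × List Γ → ENNReal}
    (hh : ∀ p Z β, a + stepSum Δ.ennrealWeight p Z (fun q α => h (q, α ++ β)) ≤ h (p, Z :: β))
    (p : Q) (α β : List Γ) :
    Δ.configRuntime (p, α) * a + ∑ t, Δ.terminationProb t (p, α) * h (t, β) ≤ h (p, α ++ β) := by
  classical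
  -- Truncation to `n` terms permits induction. When the upper part is empty, no reward has accrued
  -- and the sum over `t` collapses to `h (p, β)`.
  have key : ∀ n p α,
      partialNeumann Δ.stepOperator ((emptyStack Q Γ)ᶜ.indicator 1) n (p, α) * a +
        ∑ t, partialNeumann Δ.stepOperator (Pi.single (t, []) 1) n (p, α) * h (t, β) ≤
      h (p, α ++ β) := by
    intro n
    induction n with
    | zero => simp
    | succ n ih =>
      rintro p (_ | ⟨Z, α⟩)
      · rw [partialNeumann_succ Δ.stepOperator_countablyAdditive, Pi.add_apply,
          stepOperator_nil, compl_emptyStack_indicator_nil]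
        simp [partialTermination_succ_nil]
      · rw [partialNeumann_succ Δ.stepOperator_countablyAdditive, Pi.add_apply,
          stepOperator_cons, compl_emptyStack_indicator_cons]
        simp only [partialTermination_succ_cons, add_mul, one_mul]
        simp only [← stepSum_mul_right, ← stepSum_sum]
        rw [add_assoc, ← stepSum_add]
        refine le_trans ?_ (hh p Z (α ++ β))
        gcongr
        refine stepSum_mono fun q γ => ?_
        simpa using ih q (γ ++ α)
  rw [configRuntime_eq_neumann]
  simp only [terminationProb, neumann, ← ENNReal.tsum_mul_right]
  rw [← Summable.tsum_finsetSum fun _ _ => ENNReal.summable, ← ENNReal.tsum_add]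
  refine ENNReal.tsum_le_of_sum_range_le fun n => ?_
  rw [sum_add_distrib, sum_comm]
  simpa only [partialNeumann_apply, sum_mul] using key n p α

theorem configRuntime_append_le (Δ : WeightedPDA Q Γ) (p : Q) (α β : List Γ) :
    Δ.configRuntime (p, α) + ∑ t, Δ.terminationProb t (p, α) * Δ.configRuntime (t, β) ≤
      Δ.configRuntime (p, α ++ β) := by
  simpa using Δ.superharmonic_append (a := 1) (h := Δ.configRuntime)
    (fun p Z β => (Δ.configRuntime_cons p Z β).ge) p α β

/-- Reward zero removes the runtime term even when it is infinite, since `⊤ * 0 = 0`. -/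
theorem terminationProb_append_le (Δ : WeightedPDA Q Γ) (q p : Q) (α β : List Γ) :
    ∑ t, Δ.terminationProb t (p, α) * Δ.terminationProb q (t, β) ≤
      Δ.terminationProb q (p, α ++ β) := by
  simpa using Δ.superharmonic_append (a := 0) (h := Δ.terminationProb q)
    (fun p Z β => by rw [zero_add, Δ.terminationProb_cons]) p α β

/-- The termination probabilities form a pre-fixed point of the fundamental system. -/
theorem fundamental_terminationProb_le (Δ : WeightedPDA Q Γ) (i : Q × Γ × Q) :
    fundamental Δ.ennrealWeight (fun i => Δ.terminationProb i.2.2 (i.1, [i.2.1])) i ≤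
      Δ.terminationProb i.2.2 (i.1, [i.2.1]) := by
  classical
  obtain ⟨p, Z, q⟩ := i
  rw [terminationProb_cons]
  simp only [stepSum, List.append_nil, sum_add_distrib, terminationProb_nil, mul_ite, mul_one,
    mul_zero, sum_ite_eq', mem_univ, if_true, fundamental, linearPart, bilinearPart]
  gcongr with r _ Y _ X _
  exact Δ.terminationProb_append_le q r [Y] [X]

/-- The expected runtimes satisfy the inequality of the runtime system at the termination
probabilities. -/
theorem runtimeMap_configRuntime_le (Δ : WeightedPDA Q Γ) (j : Q × Γ) :
    runtimeMap Δ.ennrealWeight (fun i => Δ.terminationProb i.2.2 (i.1, [i.2.1]))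
      (fun j => Δ.configRuntime (j.1, [j.2])) j + 1 ≤ Δ.configRuntime (j.1, [j.2]) := by
  obtain ⟨p, Z⟩ := j
  rw [configRuntime_cons, add_comm]
  simp only [stepSum, List.append_nil, sum_add_distrib, configRuntime_nil, mul_zero,
    zero_add, runtimeMap]
  gcongr with r _ Y _ X _
  exact Δ.configRuntime_append_le r [Y] [X]

end Fintype

end WeightedPDA

/-! ### Perturbation to strict inequalities and rational approximation. -/

theorem NNRat.denseRange_cast_nnreal : DenseRange ((↑) : ℚ≥0 → NNReal) := by
  refine dense_of_exists_between fun a b hab => ?_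
  obtain ⟨q, haq, hqb⟩ := exists_rat_btwn (NNReal.coe_lt_coe.2 hab)
  have hq : 0 ≤ q := by exact_mod_cast a.coe_nonneg.trans haq.le
  lift q to ℚ≥0 using hq
  exact ⟨(q : NNReal), ⟨q, rfl⟩, by exact_mod_cast haq, by exact_mod_cast hqb⟩

namespace WeightedPDA

variable {Q Γ : Type*} [Fintype Q] [Fintype Γ]

section Derivative

variable {R : Type*} [CommSemiring R]

/-- The derivative of the fundamental system at `u`, applied to `v`. -/
def fundamentalDeriv (w : Q → Γ → Q → List Γ → R) (u v : Q × Γ × Q → R) : Q × Γ × Q → R :=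
  fun i => linearPart w v i + bilinearPart w v u i + bilinearPart w u v i

/-- The Taylor expansion of the fundamental system. -/
theorem fundamental_add_mul (w : Q → Γ → Q → List Γ → R) (u v : Q × Γ × Q → R) (ε : R)
    (i : Q × Γ × Q) :
    fundamental w (fun j => u j + ε * v j) i =
      fundamental w u i + ε * fundamentalDeriv w u v i + ε * (ε * bilinearPart w v v i) := by
  have h1 : linearPart w (fun j => u j + ε * v j) i =
      linearPart w u i + ε * linearPart w v i := by
    simp only [linearPart, mul_add, sum_add_distrib, mul_sum, mul_left_comm]
  have h2 : bilinearPart w (fun j => u j + ε * v j) (fun j => u j + ε * v j) i =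
      bilinearPart w u u i + ε * (bilinearPart w v u i + bilinearPart w u v i) +
        ε * (ε * bilinearPart w v v i) := by
    simp only [bilinearPart, mul_sum, ← sum_add_distrib]
    exact sum_congr rfl fun r _ => sum_congr rfl fun Y _ => sum_congr rfl fun X _ =>
      sum_congr rfl fun t _ => by ring
  simp only [fundamental, fundamentalDeriv, h1, h2]
  ring

theorem map_fundamentalDeriv {R' : Type*} [CommSemiring R'] (φ : R →+* R')
    (w : Q → Γ → Q → List Γ → R) (u v : Q × Γ × Q → R) (i : Q × Γ × Q) :
    φ (fundamentalDeriv w u v i) = fundamentalDeriv (fun p Z q α => φ (w p Z q α))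
      (fun j => φ (u j)) (fun j => φ (v j)) i := by
  simp [fundamentalDeriv, linearPart, bilinearPart]

theorem runtimeMap_mul_left (w : Q → Γ → Q → List Γ → R) (u : Q × Γ × Q → R) (v : Q × Γ → R)
    (c : R) (j : Q × Γ) : runtimeMap w u (fun k => c * v k) j = c * runtimeMap w u v j := by
  simp only [runtimeMap, mul_add, mul_sum, mul_left_comm]

end Derivative

theorem fundamentalDeriv_countablyAdditive (w : Q → Γ → Q → List Γ → ENNReal)
    (u : Q × Γ × Q → ENNReal) : CountablyAdditive (fundamentalDeriv w u) where
  map_zero := by funext i; simp [fundamentalDeriv, linearPart, bilinearPart]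
  map_add v v' := by
    funext i
    simp only [fundamentalDeriv, linearPart, bilinearPart, Pi.add_apply, mul_add, add_mul,
      sum_add_distrib]
    ring
  map_tsum v := by
    funext i
    simp only [fundamentalDeriv, linearPart, bilinearPart, ← ENNReal.tsum_mul_left,
      ← ENNReal.tsum_mul_right,
      ← Summable.tsum_finsetSum fun _ _ => ENNReal.summable, ← ENNReal.tsum_add]

/-- Summing over the final states turns the derivative of the fundamental system into the
runtime matrix, provided that `u` is substochastic. -/
theorem sum_fundamentalDeriv_le (w : Q → Γ → Q → List Γ → ENNReal)
    {u : Q × Γ × Q → ENNReal} (hu : ∀ p Z, ∑ q, u (p, Z, q) ≤ 1) (v : Q × Γ × Q → ENNReal)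
    (j : Q × Γ) :
    ∑ q, fundamentalDeriv w u v (j.1, j.2, q) ≤
      runtimeMap w u (fun k => ∑ q, v (k.1, k.2, q)) j := by
  obtain ⟨p, Z⟩ := j
  have hlin : ∑ q, linearPart w v (p, Z, q) = ∑ r, ∑ Y, w p Z r [Y] * ∑ q, v (r, Y, q) := by
    simp only [linearPart, mul_sum]
    rw [sum_comm]
    exact sum_congr rfl fun r _ => sum_comm
  have hbil : ∀ x y : Q × Γ × Q → ENNReal, ∑ q, bilinearPart w x y (p, Z, q) =
      ∑ r, ∑ Y, ∑ X, w p Z r [Y, X] * ∑ t, x (r, Y, t) * ∑ q, y (t, X, q) := by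
    intro x y
    simp only [bilinearPart, mul_sum]
    rw [sum_comm]
    refine sum_congr rfl fun r _ => ?_
    rw [sum_comm]
    refine sum_congr rfl fun Y _ => ?_
    rw [sum_comm]
    exact sum_congr rfl fun X _ => sum_comm
  simp only [fundamentalDeriv, sum_add_distrib, hlin, hbil, runtimeMap, mul_add]
  rw [add_assoc]
  gcongr with r _ Y _ X _ t _
  -- Only the term differentiating the first factor loses anything: `∑ q, u (t, X, q) ≤ 1` reduces
  -- it to `∑ t, v (r, Y, t)`. The other terms agree exactly.
  exact mul_le_of_le_one_right' (hu t X)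

/-- If the system of expected runtimes has a finite solution at a substochastic `u`, then the
Neumann series of the derivative of the fundamental system at `u` is finite. -/
theorem neumann_fundamentalDeriv_lt_top {w : Q → Γ → Q → List Γ → ENNReal}
    {u : Q × Γ × Q → ENNReal} {e : Q × Γ → ENNReal} (hu : ∀ p Z, ∑ q, u (p, Z, q) ≤ 1)
    (he : ∀ j, runtimeMap w u e j + 1 ≤ e j) (hfin : ∀ j, e j < ⊤) (i : Q × Γ × Q) :
    neumann (fundamentalDeriv w u) 1 i < ⊤ := by
  have hA := fundamentalDeriv_countablyAdditive w u
  -- The factor `Fintype.card Q` is the constant vector `1` summed over final states; by linearity,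
  -- scaling `e` by it absorbs this inhomogeneity.
  have key : ∀ n j, ∑ q, partialNeumann (fundamentalDeriv w u) 1 n (j.1, j.2, q) ≤
      Fintype.card Q * e j := by
    intro n
    induction n with
    | zero => simp
    | succ n ih =>
      intro j
      simp only [partialNeumann_succ hA, Pi.add_apply, Pi.one_apply, sum_add_distrib]
      calc _ ≤ (Fintype.card Q : ENNReal) + runtimeMap w u (fun k => Fintype.card Q * e k) j := by
            gcongr
            · simp
            · refine (sum_fundamentalDeriv_le w hu _ j).trans ?_
              simp only [runtimeMap]
              gcongr <;> exact ih (_, _)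
        _ = Fintype.card Q * (runtimeMap w u e j + 1) := by
            rw [runtimeMap_mul_left]
            ring
        _ ≤ _ := by gcongr; exact he j
  refine lt_of_le_of_lt (neumann_le_of_partialNeumann_le fun n => ?_)
    (ENNReal.mul_lt_top (ENNReal.natCast_lt_top (Fintype.card Q)) (hfin (i.1, i.2.1)))
  exact (single_le_sum (f := fun q => partialNeumann (fundamentalDeriv w u) 1 n (i.1, i.2.1, q))
    (fun _ _ => zero_le) (mem_univ i.2.2)).trans (key n (i.1, i.2.1))

theorem continuous_fundamental (w : Q → Γ → Q → List Γ → NNReal) (i : Q × Γ × Q) :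
    Continuous fun x : Q × Γ × Q → NNReal => fundamental w x i := by
  unfold fundamental linearPart bilinearPart
  fun_prop

theorem continuous_runtimeMap (w : Q → Γ → Q → List Γ → NNReal) (j : Q × Γ) :
    Continuous fun x : (Q × Γ × Q → NNReal) × (Q × Γ → NNReal) => runtimeMap w x.1 x.2 j := by
  unfold runtimeMap
  fun_prop

/-- Approximate solutions of the strict inequalities in non-negative reals by rational ones. -/
theorem exists_rational_of_strict (w : Q → Γ → Q → List Γ → ℚ≥0) {x : Q × Γ × Q → NNReal}
    {v : Q × Γ → NNReal} (hx : ∀ i, fundamental (fun p Z q α => (w p Z q α : NNReal)) x i < x i)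
    (h1 : ∀ j, 1 < v j)
    (hv : ∀ j, runtimeMap (fun p Z q α => (w p Z q α : NNReal)) x v j + 1 < v j) :
    ∃ (u : Q × Γ × Q → ℚ≥0) (r : Q × Γ → ℚ≥0), (∀ i, fundamental w u i ≤ u i) ∧
      (∀ j, 1 ≤ r j) ∧ ∀ j, runtimeMap w u r j + 1 ≤ r j := by
  set W : Q → Γ → Q → List Γ → NNReal := fun p Z q α => (w p Z q α : NNReal) with hW
  let U : Set ((Q × Γ × Q → NNReal) × (Q × Γ → NNReal)) :=
    {y | (∀ i, fundamental W y.1 i < y.1 i) ∧ (∀ j, 1 < y.2 j) ∧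
      ∀ j, runtimeMap W y.1 y.2 j + 1 < y.2 j}
  -- Finitely many strict inequalities between continuous functions define an open set, which
  -- therefore meets the dense set of rational points.
  have hU : IsOpen U := by
    simp only [U, Set.ofPred_and, Set.ofPred_forall]
    refine IsOpen.inter (isOpen_iInter_of_finite fun i => ?_)
      (IsOpen.inter (isOpen_iInter_of_finite fun j => ?_) (isOpen_iInter_of_finite fun j => ?_))
    · exact isOpen_lt ((continuous_fundamental W i).comp continuous_fst) (by fun_prop)
    · exact isOpen_lt continuous_const (by fun_prop)
    · exact isOpen_lt ((continuous_runtimeMap W j).add continuous_const) (by fun_prop)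
  have hdense : DenseRange (Prod.map (Pi.map fun _ : Q × Γ × Q => ((↑) : ℚ≥0 → NNReal))
      (Pi.map fun _ : Q × Γ => ((↑) : ℚ≥0 → NNReal))) :=
    (DenseRange.piMap fun _ => NNRat.denseRange_cast_nnreal).prodMap
      (DenseRange.piMap fun _ => NNRat.denseRange_cast_nnreal)
  obtain ⟨⟨u, r⟩, h₁, h₂, h₃⟩ := hdense.exists_mem_open hU ⟨(x, v), hx, h1, hv⟩
  simp only [Prod.map_apply, Pi.map_apply] at h₁ h₂ h₃
  refine ⟨u, r, fun i => ?_, fun j => ?_, fun j => ?_⟩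
  · have h : fundamental W (fun k => (u k : NNReal)) i ≤ u i := (h₁ i).le
    have hm := map_fundamental (NNRat.castHom NNReal) w u i
    have h' : ((fundamental w u i : ℚ≥0) : NNReal) ≤ u i := hm.trans_le h
    exact_mod_cast h'
  · exact_mod_cast (h₂ j).le
  · have h : runtimeMap W (fun k => (u k : NNReal)) (fun k => (r k : NNReal)) j + 1 ≤ r j :=
      (h₃ j).le
    have hm := map_runtimeMap (NNRat.castHom NNReal) w u r j
    have h' : ((runtimeMap w u r j : ℚ≥0) : NNReal) + 1 ≤ r j :=
      (congrArg (· + 1) hm).trans_le h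
    exact_mod_cast h'

/-- A finite solution of the system of expected runtimes at a substochastic pre-fixed point of the
fundamental system can be perturbed to strict solutions of both systems of inequalities. -/
theorem exists_strict {w : Q → Γ → Q → List Γ → NNReal} {u : Q × Γ × Q → ENNReal}
    {e : Q × Γ → ENNReal} (hf : ∀ i, fundamental (fun p Z q α => (w p Z q α : ENNReal)) u i ≤ u i)
    (hu : ∀ p Z, ∑ q, u (p, Z, q) ≤ 1)
    (he : ∀ j, runtimeMap (fun p Z q α => (w p Z q α : ENNReal)) u e j + 1 ≤ e j)
    (hfin : ∀ j, e j < ⊤) :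
    ∃ (x : Q × Γ × Q → NNReal) (v : Q × Γ → NNReal), (∀ i, fundamental w x i < x i) ∧
      (∀ j, 1 < v j) ∧ ∀ j, runtimeMap w x v j + 1 < v j := by
  have hv_fin := neumann_fundamentalDeriv_lt_top hu he hfin
  lift e to Q × Γ → NNReal using fun j => (hfin j).ne
  lift u to Q × Γ × Q → NNReal using fun i =>
    ((single_le_sum (f := fun q => u (i.1, i.2.1, q)) (fun _ _ => zero_le)
      (mem_univ i.2.2)).trans_lt ((hu i.1 i.2.1).trans_lt ENNReal.one_lt_top)).ne
  replace hf : ∀ i, fundamental w u i ≤ u i := fun i => ENNReal.coe_le_coe.1 <|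
    (map_fundamental ENNReal.ofNNRealHom w u i).trans_le (hf i)
  replace he : ∀ j, runtimeMap w u e j + 1 ≤ e j := fun j => by
    have h : ((runtimeMap w u e j : NNReal) : ENNReal) + 1 ≤ e j :=
      (congrArg (· + 1) (map_runtimeMap ENNReal.ofNNRealHom w u e j)).trans_le (he j)
    exact_mod_cast h
  have hA := neumann_eq (fundamentalDeriv_countablyAdditive
    (fun p Z q α => (w p Z q α : ENNReal)) (fun i => (u i : ENNReal))) 1
  set v' := neumann (fundamentalDeriv (fun p Z q α => (w p Z q α : ENNReal))
    (fun i => (u i : ENNReal))) 1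
  lift v' to Q × Γ × Q → NNReal using fun i => (hv_fin i).ne with v
  have hv : ∀ i, v i = 1 + fundamentalDeriv w u v i := by
    intro i
    have h := map_fundamentalDeriv ENNReal.ofNNRealHom w u v i
    have h' := congrFun hA i
    rw [Pi.add_apply, Pi.one_apply] at h'
    have h₁ : ((v i : NNReal) : ENNReal) = 1 + (fundamentalDeriv w u v i : NNReal) :=
      h'.trans (congrArg (1 + ·) h.symm)
    exact_mod_cast h₁
  -- Both bounds hold at `ε = 0` and are continuous in `ε`, so they persist for small positive `ε`.
  have hε : ∀ᶠ ε : NNReal in nhdsWithin 0 (Set.Ioi 0), 0 < ε ∧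
      (∀ i, ε * bilinearPart w v v i < 1) ∧
      ∀ j, runtimeMap w (fun i => u i + ε * v i) e j < runtimeMap w u e j + 1 / 2 := by
    refine Filter.Eventually.and self_mem_nhdsWithin (Filter.Eventually.filter_mono
      nhdsWithin_le_nhds (Filter.Eventually.and ?_ ?_)) <;> rw [Filter.eventually_all]
    · intro i
      have hc : Continuous fun ε : NNReal => ε * bilinearPart w v v i := by fun_prop
      exact (hc.tendsto 0).eventually_lt_const (by simp)
    · intro j
      have hc : Continuous fun ε : NNReal => runtimeMap w (fun i => u i + ε * v i) e j :=
        (continuous_runtimeMap w j).comp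
          (f := fun ε : NNReal => ((fun i => u i + ε * v i), e)) (by fun_prop)
      refine (hc.tendsto 0).eventually_lt_const ?_
      simp
  obtain ⟨ε, hε0, hε1, hε2⟩ := hε.exists
  -- Doubling `e` turns the perturbation error, less than `1 / 2`, into one less than `1`, exactly
  -- the surplus in `2 * (runtimeMap w u e j + 1) ≤ 2 * e j`. It also gives `1 < 2 * e j`, as `1 ≤ e
  -- j`.
  refine ⟨fun i => u i + ε * v i, fun j => 2 * e j, fun i => ?_, fun j => ?_, fun j => ?_⟩
  · rw [fundamental_add_mul]
    calc _ < fundamental w u i + ε * fundamentalDeriv w u v i + ε * 1 := by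
          gcongr
          exact hε1 i
      _ = fundamental w u i + ε * (1 + fundamentalDeriv w u v i) := by ring
      _ ≤ u i + ε * v i := by
          rw [← hv]
          gcongr
          exact hf i
  · have h1 : 1 ≤ e j := le_add_self.trans (he j)
    calc (1 : NNReal) < 2 * 1 := by norm_num
      _ ≤ 2 * e j := by gcongr
  · rw [runtimeMap_mul_left]
    calc _ < 2 * (runtimeMap w u e j + 1 / 2) + 1 := by
          gcongr
          exact hε2 j
      _ = 2 * (runtimeMap w u e j + 1) := by
          rw [mul_add, mul_add, mul_one_div_cancel two_ne_zero]; ring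
      _ ≤ 2 * e j := by gcongr; exact he j

/-! ### Certificates and positive almost-sure termination. -/

theorem IsPASTCertificate.configRuntime_le {Δ : WeightedPDA Q Γ} {u : Q × Γ × Q → ℚ≥0}
    {r : Q × Γ → ℚ≥0} (h : Δ.IsPASTCertificate u r) (p : Q) (α : List Γ) :
    Δ.configRuntime (p, α) ≤
      potential (fun i => ennrealCastHom (u i)) (fun j => ennrealCastHom (r j)) α p := by
  rw [isPASTCertificate_iff] at h
  have hmono : Monotone ennrealCastHom := fun a b hab => by
    rw [ennrealCastHom_apply, ennrealCastHom_apply]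
    exact_mod_cast hab
  refine Δ.configRuntime_le_potential (fun i => ?_) (fun j => ?_) p α
  · exact (map_fundamental ennrealCastHom Δ.weight u i).symm.trans_le (hmono (h.1 i))
  · have h' := hmono (h.2.2 j)
    rw [map_add, map_one] at h'
    exact (congrArg (· + 1) (map_runtimeMap ennrealCastHom Δ.weight u r j)).symm.trans_le h'

theorem IsPAST.exists_certificate {Δ : WeightedPDA Q Γ} (hΔ : Δ.IsProbabilistic)
    (h : Δ.IsPAST) : ∃ u r, Δ.IsPASTCertificate u r := by
  simp only [isPASTCertificate_iff]
  obtain ⟨x, v, hx, h1, hv⟩ := exists_strict (w := fun p Z q α => (Δ.weight p Z q α : NNReal))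
    Δ.fundamental_terminationProb_le (fun p Z => sum_terminationProb_le_one hΔ (p, [Z]))
    Δ.runtimeMap_configRuntime_le (fun j => h (j.1, [j.2]))
  exact exists_rational_of_strict Δ.weight hx h1 hv

end WeightedPDA

end

theorem theorem8 {Q Γ : Type*} [Fintype Q] [Fintype Γ] (Δ : WeightedPDA Q Γ)
    (hΔ : Δ.IsProbabilistic) :
    (Δ.IsPAST ↔ ∃ (u : Q × Γ × Q → ℚ≥0) (r : Q × Γ → ℚ≥0), Δ.IsPASTCertificate u r) ∧
    ∀ (u : Q × Γ × Q → ℚ≥0) (r : Q × Γ → ℚ≥0), Δ.IsPASTCertificate u r →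
      ∀ p Z, Δ.ert p Z ≤ ((r (p, Z) : NNReal) : ENNReal) := by
  refine ⟨⟨fun h => h.exists_certificate hΔ, ?_⟩, fun u r h p Z => ?_⟩
  · rintro ⟨u, r, h⟩ ⟨p, α⟩
    exact (h.configRuntime_le p α).trans_lt (WeightedPDA.potential_lt_top
      (fun _ => ENNReal.coe_lt_top) (fun _ => ENNReal.coe_lt_top) α p)
  · refine (h.configRuntime_le p [Z]).trans_eq ?_
    simp [WeightedPDA.potential, WeightedPDA.ennrealCastHom_apply]
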